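/- Theorem (Aubin–Lions lemma). Let $n\ge 1$ and let $X_n,\dots,X_0$ and $Y_{n-1},\dots,Y_0$ be (real) Banach spaces, all $X_k$ reflexive, together with continuous linear embeddings (injections) $Y_k\hookrightarrow X_k$ for $0\le k\le n-1$ and compact linear embeddings $X_k\hookrightarrow Y_{k-1}$ for $1\le k\le n$, that is, $$X_n \overset{cpt}{\hookrightarrow} Y_{n-1} \hookrightarrow X_{n-1} \overset{cpt}{\hookrightarrow} \cdots \hookrightarrow X_1 \overset{cpt}{\hookrightarrow} Y_0 \hookrightarrow X_0 .$$ Let $I=[a,b]$, $-\infty<a\le b<\infty$, with the Lebesgue measure, let $\hat p=(p_n,\dots,p_0)\in[1,\infty]^{n+1}$ and $\tilde p=(p_n,\dots,p_1)$, and assume that $p_k<\infty$ or $p_{k-1}>1$ for every $1\le k\le n$ (this holds in particular if $1<p_k<\infty$ for all $k$). For a chain $Z_m\hookrightarrow\cdots\hookrightarrow Z_0$ of continuously embedded Banach spaces, $\hat Z=(Z_m,\dots,Z_0)$ and $\hat q=(q_m,\dots,q_0)\in[1,\infty]^{m+1}$, the $m$-th Bochner–Sobolev space is $$W^{m,\hat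 q}(I,\hat Z)=\{u\in L^{q_m}(I,Z_m) : \text{for } 1\le k\le m \text{ the weak derivative } u^{(k)} \text{ exists and lies in } L^{q_{m-k}}(I,Z_{m-k})\},$$ with the norm $\|u\|=\sum_{k=0}^m\|u^{(k)}\|_{L^{q_{m-k}}(I,Z_{m-k})}$, where $v=u^{(k)}$ means that $\int_I\varphi^{(k)}(t)u(t)\,dt=(-1)^k\int_I\varphi(t)v(t)\,dt$ (Bochner integrals in $Z_{m-k}$) for all real-valued $\varphi\in C_c^\infty((a,b))$. Write $\hat X=(X_n,\dots,X_0)$ and $\hat Y=(Y_{n-1},\dots,Y_0)$. Then composition with the embedding $X_n\hookrightarrow Y_{n-1}$ defines an embedding (a continuous linear injection) $$W^{n,\hat p}(I,\hat X)\hookrightarrow W^{n-1,\tilde p}(I,\hat Y),$$ and this embedding is compact. -/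

import Mathlib

open MeasureTheory
open scoped ENNReal ContDiff

noncomputable section

/-- `v : ℝ → Y` is a weak `k`-th derivative on `I` of `u : ℝ → X`, where `X` is embedded into `Y`
by `ι`: for all real test functions `φ ∈ C_c^∞(int I)`,
`∫_I φ⁽ᵏ⁾(t) u(t) dt = (-1)ᵏ ∫_I φ(t) v(t) dt` (Bochner integrals with values in `Y`). -/
def HasWeakDeriv {X Y : Type*} [NormedAddCommGroup X] [NormedSpace ℝ X]
    [NormedAddCommGroup Y] [NormedSpace ℝ Y] (I : Set ℝ) (ι : X →L[ℝ] Y) (k : ℕ)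
    (u : ℝ → X) (v : ℝ → Y) : Prop :=
  ∀ φ : ℝ → ℝ, ContDiff ℝ ∞ φ → HasCompactSupport φ → tsupport φ ⊆ interior I →
    ∫ t in I, iteratedDeriv k φ t • ι (u t) = (-1 : ℝ) ^ k • ∫ t in I, φ t • v t

/-- The composite embedding `X_n ↪ X_k` of a chain `X_n ↪ X_{n-1} ↪ ... ↪ X_0` with the steps
`e k : X_{k+1} ↪ X_k`. -/
def chainMap {n : ℕ} {X : Fin (n + 1) → Type*} [∀ k, NormedAddCommGroup (X k)]
    [∀ k, NormedSpace ℝ (X k)] (e : ∀ k : Fin n, X k.succ →L[ℝ] X k.castSucc)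
    (k : Fin (n + 1)) : X (Fin.last n) →L[ℝ] X k :=
  Fin.reverseInduction (motive := fun k => X (Fin.last n) →L[ℝ] X k)
    (ContinuousLinearMap.id ℝ _) (fun k f => (e k).comp f) k

section Auxiliary

variable {X Y : Type*} [NormedAddCommGroup X] [NormedSpace ℝ X]
  [NormedAddCommGroup Y] [NormedSpace ℝ Y]

theorem integrable_test_smul {I : Set ℝ} {p : ℝ≥0∞} [hp : Fact (1 ≤ p)] (ι : X →L[ℝ] Y)
    (u : Lp X p (volume.restrict I)) {φ : ℝ → ℝ} (h1 : Continuous φ) (h2 : HasCompactSupport φ) :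
    Integrable (fun t => φ t • ι (u t)) (volume.restrict I) := by
  have h : LocallyIntegrable (fun t => ι (u t)) (volume.restrict I) :=
    (ι.comp_memLp u).locallyIntegrable hp.out
  exact h.integrable_smul_left_of_hasCompactSupport h1 h2

theorem continuous_iteratedDeriv_test {φ : ℝ → ℝ} (h1 : ContDiff ℝ ∞ φ) (k : ℕ) :
    Continuous (iteratedDeriv k φ) :=
  h1.continuous_iteratedDeriv k (by exact_mod_cast le_top)

theorem hasCompactSupport_iteratedDeriv_test {φ : ℝ → ℝ} (h : HasCompactSupport φ) (k : ℕ) :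
    HasCompactSupport (iteratedDeriv k φ) := by
  induction k with
  | zero => simpa using h
  | succ k ih => rw [iteratedDeriv_succ]; exact ih.deriv

theorem HasWeakDeriv.add {I : Set ℝ} {p q : ℝ≥0∞} [Fact (1 ≤ p)] [Fact (1 ≤ q)]
    {ι : X →L[ℝ] Y} {k : ℕ} {u u' : Lp X p (volume.restrict I)} {v v' : Lp Y q (volume.restrict I)}
    (h : HasWeakDeriv I ι k u v) (h' : HasWeakDeriv I ι k u' v') :
    HasWeakDeriv I ι k (u + u' : Lp X p (volume.restrict I))
      (v + v' : Lp Y q (volume.restrict I)) := by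
  intro φ h1 h2 h3
  have c := continuous_iteratedDeriv_test h1 k
  have s := hasCompactSupport_iteratedDeriv_test h2 k
  have e1 : ∫ t in I, iteratedDeriv k φ t • ι ((u + u' : Lp X p (volume.restrict I)) t)
      = ∫ t in I, (iteratedDeriv k φ t • ι (u t) + iteratedDeriv k φ t • ι (u' t)) := by
    refine integral_congr_ae ?_
    filter_upwards [Lp.coeFn_add u u'] with t ht
    rw [ht]; simp
  have e2 : ∫ t in I, φ t • (v + v' : Lp Y q (volume.restrict I)) t
      = ∫ t in I, (φ t • v t + φ t • v' t) := by
    refine integral_congr_ae ?_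
    filter_upwards [Lp.coeFn_add v v'] with t ht
    rw [ht]; simp
  have i1 : Integrable (fun t => φ t • v t) (volume.restrict I) :=
    integrable_test_smul (.id ℝ Y) v h1.continuous h2
  have i2 : Integrable (fun t => φ t • v' t) (volume.restrict I) :=
    integrable_test_smul (.id ℝ Y) v' h1.continuous h2
  rw [e1, e2, integral_add (integrable_test_smul ι u c s) (integrable_test_smul ι u' c s),
    integral_add i1 i2, h φ h1 h2 h3, h' φ h1 h2 h3, smul_add]

theorem HasWeakDeriv.smul {I : Set ℝ} {p q : ℝ≥0∞} {ι : X →L[ℝ] Y} {k : ℕ}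
    {u : Lp X p (volume.restrict I)} {v : Lp Y q (volume.restrict I)} (c : ℝ)
    (h : HasWeakDeriv I ι k u v) :
    HasWeakDeriv I ι k (c • u : Lp X p (volume.restrict I))
      (c • v : Lp Y q (volume.restrict I)) := by
  intro φ h1 h2 h3
  have e1 : ∫ t in I, iteratedDeriv k φ t • ι ((c • u : Lp X p (volume.restrict I)) t)
      = ∫ t in I, c • (iteratedDeriv k φ t • ι (u t)) := by
    refine integral_congr_ae ?_
    filter_upwards [Lp.coeFn_smul c u] with t ht
    rw [ht]; simp [smul_comm c]
  have e2 : ∫ t in I, φ t • (c • v : Lp Y q (volume.restrict I)) t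
      = ∫ t in I, c • (φ t • v t) := by
    refine integral_congr_ae ?_
    filter_upwards [Lp.coeFn_smul c v] with t ht
    rw [ht]; simp [smul_comm c]
  rw [e1, e2, integral_smul, integral_smul, h φ h1 h2 h3, smul_comm]

theorem HasWeakDeriv.zero (I : Set ℝ) (p q : ℝ≥0∞) (ι : X →L[ℝ] Y) (k : ℕ) :
    HasWeakDeriv I ι k (0 : Lp X p (volume.restrict I)) (0 : Lp Y q (volume.restrict I)) := by
  intro φ h1 h2 h3
  have e1 : ∫ t in I, iteratedDeriv k φ t • ι ((0 : Lp X p (volume.restrict I)) t)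
      = ∫ t in I, (0 : Y) := by
    refine integral_congr_ae ?_
    filter_upwards [Lp.coeFn_zero X p (volume.restrict I)] with t ht
    rw [ht]; simp
  have e2 : ∫ t in I, φ t • (0 : Lp Y q (volume.restrict I)) t = ∫ t in I, (0 : Y) := by
    refine integral_congr_ae ?_
    filter_upwards [Lp.coeFn_zero Y q (volume.restrict I)] with t ht
    rw [ht]; simp
  rw [e1, e2]; simp

/-- Weak derivatives on an interval are unique. -/
theorem HasWeakDeriv.unique [CompleteSpace Y] {I : Set ℝ} [hI : I.OrdConnected] {q : ℝ≥0∞}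
    [hq : Fact (1 ≤ q)] {ι : X →L[ℝ] Y} {k : ℕ} {u : ℝ → X} {v v' : Lp Y q (volume.restrict I)}
    (h : HasWeakDeriv I ι k u v) (h' : HasWeakDeriv I ι k u v') : v = v' := by
  have hli : LocallyIntegrable (fun t => v t - v' t) (volume.restrict I) :=
    ((Lp.memLp v).sub (Lp.memLp v')).locallyIntegrable hq.out
  have key : ∀ᵐ t ∂(volume.restrict I), t ∈ interior I → v t - v' t = 0 := by
    refine isOpen_interior.ae_eq_zero_of_integral_contDiff_smul_eq_zero
      (hli.locallyIntegrableOn _) ?_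
    intro φ h1 h2 h3
    have a := (h φ h1 h2 h3).symm.trans (h' φ h1 h2 h3)
    have a' : ∫ t in I, φ t • v t = ∫ t in I, φ t • v' t :=
      smul_right_injective Y (pow_ne_zero k (by norm_num : (-1 : ℝ) ≠ 0)) a
    simp only [smul_sub]
    have i1 : Integrable (fun t => φ t • v t) (volume.restrict I) :=
      integrable_test_smul (.id ℝ Y) v h1.continuous h2
    have i2 : Integrable (fun t => φ t • v' t) (volume.restrict I) :=
      integrable_test_smul (.id ℝ Y) v' h1.continuous h2
    rw [integral_sub i1 i2]
    exact sub_eq_zero.2 a'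
  have hint : ∀ᵐ t ∂(volume.restrict I), t ∈ interior I := by
    rw [ae_restrict_iff' hI.measurableSet]
    have h0 : volume (frontier I) = 0 := hI.convex.addHaar_frontier volume
    filter_upwards [measure_eq_zero_iff_ae_notMem.1 h0] with t ht htI
    by_contra hn
    exact ht ⟨subset_closure htI, hn⟩
  refine Lp.ext ?_
  filter_upwards [key, hint] with t h1 h2
  exact sub_eq_zero.1 (h1 h2)

end Auxiliary

section Sobolev

variable {n : ℕ} (I : Set ℝ) (X : Fin (n + 1) → Type*) [∀ k, NormedAddCommGroup (X k)]
  [∀ k, NormedSpace ℝ (X k)] (p : Fin (n + 1) → ℝ≥0∞) [∀ k, Fact (1 ≤ p k)]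
  (e : ∀ k : Fin n, X k.succ →L[ℝ] X k.castSucc)

/-- The `u ∈ L^{p_n}(I, X_n)` whose weak derivative of order `n - k` exists and lies in
`L^{p_k}(I, X_k)`, for all `k = 0, ..., n` (here `k ≤ n`, so `n - k` is not truncated). -/
def sobolevSubmodule : Submodule ℝ (Lp (X (Fin.last n)) (p (Fin.last n)) (volume.restrict I)) where
  carrier := {u | ∀ k : Fin (n + 1), ∃ v : Lp (X k) (p k) (volume.restrict I),
    HasWeakDeriv I (chainMap e k) (n - (k : ℕ)) u v}
  add_mem' hu hu' k := by
    obtain ⟨v, hv⟩ := hu k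
    obtain ⟨v', hv'⟩ := hu' k
    exact ⟨v + v', hv.add hv'⟩
  zero_mem' k := ⟨0, HasWeakDeriv.zero _ _ _ _ _⟩
  smul_mem' c u hu k := by
    obtain ⟨v, hv⟩ := hu k
    exact ⟨c • v, hv.smul c⟩

/-- The `n`-th Bochner-Sobolev space `W^{n,p̂}(I, X̂)` of the chain
`X_n ↪ X_{n-1} ↪ ... ↪ X_0` with the steps `e k : X_{k+1} ↪ X_k`. -/
def BochnerSobolev : Type _ := ↥(sobolevSubmodule I X p e)

namespace BochnerSobolev

instance : AddCommGroup (BochnerSobolev I X p e) :=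
  inferInstanceAs (AddCommGroup ↥(sobolevSubmodule I X p e))

instance : Module ℝ (BochnerSobolev I X p e) :=
  inferInstanceAs (Module ℝ ↥(sobolevSubmodule I X p e))

variable {I X p e}

/-- The element of `L^{p_n}(I, X_n)` underlying an element of `W^{n,p̂}(I, X̂)`. -/
def toLp (u : BochnerSobolev I X p e) :
    Lp (X (Fin.last n)) (p (Fin.last n)) (volume.restrict I) := u.1

/-- The component in `L^{p_k}(I, X_k)`: the weak derivative of order `n - k`. -/
def weakDeriv (u : BochnerSobolev I X p e) (k : Fin (n + 1)) :
    Lp (X k) (p k) (volume.restrict I) := (u.2 k).choose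

theorem hasWeakDeriv (u : BochnerSobolev I X p e) (k : Fin (n + 1)) :
    HasWeakDeriv I (chainMap e k) (n - (k : ℕ)) (toLp u) (weakDeriv u k) := (u.2 k).choose_spec

variable [∀ k, CompleteSpace (X k)] [I.OrdConnected]

theorem weakDeriv_last (u : BochnerSobolev I X p e) : weakDeriv u (Fin.last n) = toLp u := by
  refine (hasWeakDeriv u (Fin.last n)).unique ?_
  intro φ _ _ _
  simp [chainMap]

variable (I X p e) in
/-- The linear map `u ↦ (u, u', ..., u⁽ⁿ⁾)` into the product of the spaces `L^{p_k}(I, X_k)`, with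
the sum of the norms. -/
def jet : BochnerSobolev I X p e →ₗ[ℝ]
    PiLp 1 (fun k : Fin (n + 1) => Lp (X k) (p k) (volume.restrict I)) where
  toFun u := WithLp.toLp 1 (weakDeriv u)
  map_add' u u' := by
    ext1 k
    exact (hasWeakDeriv (u + u') k).unique ((hasWeakDeriv u k).add (hasWeakDeriv u' k))
  map_smul' c u := by
    ext1 k
    exact (hasWeakDeriv (c • u) k).unique ((hasWeakDeriv u k).smul c)

theorem jet_injective : Function.Injective (jet I X p e) := by
  intro u u' h
  have h1 : weakDeriv u (Fin.last n) = weakDeriv u' (Fin.last n) :=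
    congrArg (fun w => w (Fin.last n)) h
  rw [weakDeriv_last, weakDeriv_last] at h1
  exact Subtype.ext h1

instance : NormedAddCommGroup (BochnerSobolev I X p e) :=
  NormedAddCommGroup.induced _ _ (jet I X p e) jet_injective

instance : NormedSpace ℝ (BochnerSobolev I X p e) :=
  NormedSpace.induced ℝ (BochnerSobolev I X p e) _ (jet I X p e)

/-- The norm of `W^{n,p̂}(I, X̂)` is the sum of the norms of the weak derivatives. -/
theorem norm_eq_sum (u : BochnerSobolev I X p e) : ‖u‖ = ∑ k, ‖weakDeriv u k‖ := by
  change ‖jet I X p e u‖ = _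
  rw [PiLp.norm_eq_of_L1]
  rfl

end BochnerSobolev

end Sobolev

/-- A reflexive normed space: the canonical map into the bidual is onto. -/
def IsReflexiveSpace (E : Type*) [NormedAddCommGroup E] [NormedSpace ℝ E] : Prop :=
  Function.Surjective (NormedSpace.inclusionInDoubleDual ℝ E)

end

/-! Write `u_k` for the component of `u` in `L^{p_k}(I, X_k)`. Each `u_{k+1}` has `u_k` as first
weak derivative, and the embedding sends `u` to the tuple of the functions `i_k ∘ u_{k+1}` with
values in `Y_k`. Since the norm is the sum of the component norms, compactness reduces to one link
`X_{k+1} → Y_k → X_k` of the chain, the classical first-order case.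

For one link, Ehrling's lemma bounds `‖i x‖` by `ε ‖x‖ + C ‖j (i x)‖`, and the bound passes to
`L^p`. This leaves `e ∘ u` with `e = j ∘ i` compact and `u' = v` weakly. By du Bois-Reymond, `e ∘ u`
is a primitive of `v`, so its oscillation over a subinterval is at most the integral of `‖v‖` there.
Replacing `u` by its means over `N` equal cells is a compact operation once `e` is applied, with an
error in `L^p` of order `N^(-1/p)` if `p < ∞` and `N^(-(1 - 1/q))` if `p = ∞`. This is where the
condition `p_k < ∞` or `p_{k-1} > 1` enters (`HasWeakDeriv.norm_sub_stepL_le`,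
`HasWeakDeriv.norm_sub_stepL_top_le`).

Thus the embedding is bounded by a small multiple of the norm plus a multiple of a compact operator
(`IsCompactOperator.exists_norm_compLpL_le`). An operator with such bounds for every `ε` is compact
if its target is complete (`isCompactOperator_of_norm_le_add`). The target is complete because the
jets form a closed subspace of a product of `L^p` spaces. -/

noncomputable section

/-! ### Ehrling's lemma and a compactness criterion -/

section CompactOperators

variable {W V Z : Type*} [NormedAddCommGroup W] [NormedSpace ℝ W]
  [NormedAddCommGroup V] [NormedSpace ℝ V] [NormedAddCommGroup Z] [NormedSpace ℝ Z]

/-- **Ehrling's lemma** for a compact operator followed by an injective one. -/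
theorem IsCompactOperator.exists_norm_le_add {i : W →L[ℝ] V} (hi : IsCompactOperator i)
    {j : V →L[ℝ] Z} (hj : Function.Injective j) {ε : ℝ} (hε : 0 < ε) :
    ∃ C : ℝ, 0 ≤ C ∧ ∀ x, ‖i x‖ ≤ ε * ‖x‖ + C * ‖j (i x)‖ := by
  obtain ⟨K, hK, hKi⟩ := hi.image_closedBall_subset_compact (f := (i : W →ₗ[ℝ] V)) 1
  -- This part of `K` is compact and misses `0`, so the injective `j` is bounded below on it by some
  -- `δ > 0`. A unit vector's image is then either shorter than `ε` or satisfies `δ ≤ ‖j (i x)‖`.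
  have hS : IsCompact (K ∩ {y | ε ≤ ‖y‖}) :=
    hK.inter_right (isClosed_le continuous_const continuous_norm)
  obtain ⟨δ, hδ, hδK⟩ : ∃ δ : ℝ, 0 < δ ∧ ∀ y ∈ K ∩ {y | ε ≤ ‖y‖}, δ ≤ ‖j y‖ := by
    rcases (K ∩ {y | ε ≤ ‖y‖}).eq_empty_or_nonempty with h | h
    · exact ⟨1, one_pos, by simp [h]⟩
    · obtain ⟨y₀, hy₀, hmin⟩ := hS.exists_isMinOn h (f := fun y => ‖j y‖)
        (by fun_prop)
      refine ⟨‖j y₀‖, norm_pos_iff.2 fun h0 => ?_, fun y hy => hmin hy⟩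
      have : y₀ = 0 := hj (by rw [h0, map_zero])
      have h2 : ε ≤ ‖y₀‖ := hy₀.2
      rw [this, norm_zero] at h2
      exact absurd h2 (not_le.2 hε)
  have key : ∀ x, ‖x‖ ≤ 1 → ‖i x‖ ≤ ε + ‖i‖ / δ * ‖j (i x)‖ := by
    intro x hx
    rcases lt_or_ge ‖i x‖ ε with h | h
    · have : 0 ≤ ‖i‖ / δ * ‖j (i x)‖ := by positivity
      linarith
    · have h1 : δ ≤ ‖j (i x)‖ :=
        hδK _ ⟨hKi ⟨x, by simpa using hx, rfl⟩, h⟩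
      have h2 : ‖i x‖ ≤ ‖i‖ := i.unit_le_opNorm x hx
      have h3 : ‖i‖ ≤ ‖i‖ / δ * ‖j (i x)‖ := by
        rw [div_mul_eq_mul_div, le_div_iff₀ hδ]
        gcongr
      linarith
  refine ⟨‖i‖ / δ, by positivity, fun x => ?_⟩
  rcases eq_or_ne x 0 with rfl | hx
  · simp
  have hx' : 0 < ‖x‖ := norm_pos_iff.2 hx
  have h := key (‖x‖⁻¹ • x) (by rw [norm_smul, norm_inv, norm_norm, inv_mul_cancel₀ hx'.ne'])
  simp only [map_smul, norm_smul, norm_inv, norm_norm] at h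
  have h' := mul_le_mul_of_nonneg_left h hx'.le
  field_simp at h' ⊢
  linarith

/-- An operator controlled, up to arbitrarily small multiples of the norm, by compact operators is
compact. -/
theorem isCompactOperator_of_norm_le_add [CompleteSpace V] (A : W →L[ℝ] V)
    (h : ∀ ε : ℝ, 0 < ε → ∃ (C : ℝ) (B : W →L[ℝ] Z), IsCompactOperator B ∧
      ∀ u, ‖A u‖ ≤ ε * ‖u‖ + C * ‖B u‖) :
    IsCompactOperator A := by
  refine (isCompactOperator_iff_isCompact_closure_image_closedBall (A : W →ₗ[ℝ] V) one_pos).2 ?_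
  refine TotallyBounded.isCompact_of_isClosed (TotallyBounded.closure ?_) isClosed_closure
  rw [Metric.totallyBounded_iff]
  intro ε hε
  -- Two points of the unit ball differ by at most `2`, so the small term costs `ε / 2`. The term
  -- with `B` will cost at most `ε / 4`; the radius uses `|C| + 1` because `C` may be zero or
  -- negative.
  obtain ⟨C, B, hB, hC⟩ := h (ε / 4) (by positivity)
  have hBt : TotallyBounded (B '' Metric.closedBall 0 1) := by
    obtain ⟨K, hK, hKB⟩ := hB.image_closedBall_subset_compact (f := (B : W →ₗ[ℝ] Z)) 1
    exact hK.totallyBounded.subset hKB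
  have hδ : 0 < ε / (4 * (|C| + 1)) := by positivity
  -- The centres of the net are taken inside the image of the ball, so that they lift to points `g
  -- y` of the ball.
  obtain ⟨t, hts, htf, ht⟩ := totallyBounded_iff_subset.1 hBt _ (Metric.dist_mem_uniformity hδ)
  replace hts : ∀ y, y ∈ t → ∃ x, x ∈ Metric.closedBall (0 : W) 1 ∧ B x = y := fun y hy => hts hy
  choose! g hg hgB using hts
  refine ⟨(fun y => A (g y)) '' t, htf.image _, ?_⟩
  rintro _ ⟨u, hu, rfl⟩
  obtain ⟨y, hy, hyu⟩ := Set.mem_iUnion₂.1 (ht ⟨u, hu, rfl⟩)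
  refine Set.mem_iUnion₂.2 ⟨A (g y), ⟨y, hy, rfl⟩, ?_⟩
  have h1 : ‖B (u - g y)‖ < ε / (4 * (|C| + 1)) := by
    rw [map_sub, hgB y hy, ← dist_eq_norm]
    exact hyu
  have h2 : ‖u - g y‖ ≤ 2 := by
    have h3 := hg y hy
    rw [mem_closedBall_zero_iff] at h3 hu
    linarith [norm_sub_le u (g y)]
  have h4 : C * ‖B (u - g y)‖ ≤ ε / 4 := by
    calc C * ‖B (u - g y)‖ ≤ (|C| + 1) * (ε / (4 * (|C| + 1))) := by
          gcongr
          linarith [le_abs_self C]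
      _ = ε / 4 := by field_simp
  change dist (A u) (A (g y)) < ε
  rw [dist_eq_norm, ← map_sub]
  nlinarith [hC (u - g y)]

theorem IsCompactOperator.clm_pi {ι : Type*} [Finite ι] {Z : ι → Type*}
    [∀ k, NormedAddCommGroup (Z k)] [∀ k, NormedSpace ℝ (Z k)] {B : ∀ k, W →L[ℝ] Z k}
    (hB : ∀ k, IsCompactOperator (B k)) : IsCompactOperator (ContinuousLinearMap.pi B) := by
  choose K hK hKB using hB
  refine ⟨Set.pi Set.univ K, isCompact_univ_pi hK, ?_⟩
  filter_upwards [Filter.iInter_mem.2 hKB] with x hx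
  intro k _
  exact Set.mem_iInter.1 hx k

end CompactOperators

/-! ### Elementary operators on `L^p` over a finite measure space -/

section LpOperators

variable {α E F : Type*} [MeasurableSpace α] {μ : Measure α} [IsFiniteMeasure μ]
  [NormedAddCommGroup E] [NormedAddCommGroup F] [NormedSpace ℝ F]
  (p : ℝ≥0∞) [hp : Fact (1 ≤ p)]

/-- Hölder against the indicator of `s`. For `p > 1` the factor is small when `s` is, which is the
source of smallness in the `L^∞` estimate. -/
theorem MeasureTheory.Lp.setIntegral_norm_le (u : Lp E p μ) (s : Set α) :
    ∫ t in s, ‖u t‖ ∂μ ≤ μ.real s ^ (1 - 1 / p.toReal) * ‖u‖ := by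
  have h := eLpNorm_le_eLpNorm_mul_rpow_measure_univ hp.out
    (Lp.aestronglyMeasurable u).restrict (μ := μ.restrict s)
  have h' := h.trans (mul_le_mul_left (eLpNorm_mono_measure u Measure.restrict_le_self) _)
  have hint : Integrable u (μ.restrict s) := ((Lp.memLp u).integrable hp.out).restrict
  have hexp : 0 ≤ 1 - 1 / p.toReal := by
    -- For `p = ⊤` the conventions `toReal ⊤ = 0` and `1 / 0 = 0` give the correct exponent `1`.
    rcases eq_or_ne p ⊤ with rfl | hpt
    · simp
    · have : 1 ≤ p.toReal := by
        simpa using (ENNReal.toReal_le_toReal ENNReal.one_ne_top hpt).2 hp.out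
      rw [sub_nonneg, div_le_one (by linarith)]
      exact this
  have hfin : (μ.restrict s) Set.univ ^ (1 / (1 : ℝ≥0∞).toReal - 1 / p.toReal) ≠ ⊤ := by
    refine ENNReal.rpow_ne_top_of_nonneg (by simpa using hexp) (measure_ne_top _ _)
  have h'' := ENNReal.toReal_mono (ENNReal.mul_ne_top (Lp.eLpNorm_ne_top u) hfin) h'
  rw [ENNReal.toReal_mul, ← ENNReal.toReal_rpow, eLpNorm_one_eq_lintegral_enorm,
    ← integral_norm_eq_lintegral_enorm hint.1] at h''
  rw [mul_comm, Lp.norm_def]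
  simpa [Measure.real] using h''

theorem MeasureTheory.Lp.integral_norm_le (u : Lp E p μ) :
    ∫ t, ‖u t‖ ∂μ ≤ μ.real Set.univ ^ (1 - 1 / p.toReal) * ‖u‖ := by
  simpa using Lp.setIntegral_norm_le p u Set.univ

variable [NormedSpace ℝ E]

/-- The operator `u ↦ ∫ g u` on `L^p`, for a bounded weight `g` on a finite measure space. -/
def weightedIntegralL (g : α → ℝ) (hg : AEStronglyMeasurable g μ) (hb : ∃ C, ∀ t, ‖g t‖ ≤ C) :
    Lp E p μ →L[ℝ] E := by
  have hint : ∀ u : Lp E p μ, Integrable (fun t => g t • u t) μ := fun u => by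
    obtain ⟨C, hC⟩ := hb
    exact ((Lp.memLp u).integrable hp.out).bdd_smul C hg (.of_forall hC)
  refine LinearMap.mkContinuousOfExistsBound
    { toFun := fun u => ∫ t, g t • u t ∂μ
      map_add' := fun u v => ?_
      map_smul' := fun c u => ?_ } ?_
  · rw [← integral_add (hint u) (hint v)]
    refine integral_congr_ae ?_
    filter_upwards [Lp.coeFn_add u v] with t ht
    rw [ht, Pi.add_apply, smul_add]
  · rw [RingHom.id_apply, ← integral_smul]
    refine integral_congr_ae ?_
    filter_upwards [Lp.coeFn_smul c u] with t ht
    rw [ht, Pi.smul_apply, smul_comm]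
  · obtain ⟨C, hC⟩ := hb
    refine ⟨|C| * (μ.real Set.univ) ^ (1 - 1 / p.toReal), fun u => ?_⟩
    calc ‖∫ t, g t • u t ∂μ‖ ≤ ∫ t, |C| * ‖u t‖ ∂μ := by
          refine norm_integral_le_of_norm_le
            (((Lp.memLp u).integrable hp.out).norm.const_mul _) (.of_forall fun t => ?_)
          rw [norm_smul]
          gcongr
          exact (hC t).trans (le_abs_self C)
      _ ≤ _ := by
          rw [integral_const_mul, mul_assoc]
          gcongr
          exact Lp.integral_norm_le p u

theorem weightedIntegralL_apply (g : α → ℝ) (hg : AEStronglyMeasurable g μ)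
    (hb : ∃ C, ∀ t, ‖g t‖ ≤ C) (u : Lp E p μ) :
    weightedIntegralL p g hg hb u = ∫ t, g t • u t ∂μ := rfl

/-- The operator `x ↦ 1_s x` into `L^p`. -/
def indicatorConstLpL {s : Set α} (hs : MeasurableSet s) : F →L[ℝ] Lp F p μ :=
  LinearMap.mkContinuous
    { toFun := fun x => indicatorConstLp p hs (measure_ne_top μ s) x
      map_add' := fun x y => (indicatorConstLp_add).symm
      map_smul' := fun c x => by
        refine Lp.ext ?_
        filter_upwards [indicatorConstLp_coeFn (p := p) (hs := hs) (hμs := measure_ne_top μ s)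
          (c := c • x), indicatorConstLp_coeFn (p := p) (hs := hs) (hμs := measure_ne_top μ s)
          (c := x), Lp.coeFn_smul c (indicatorConstLp p hs (measure_ne_top μ s) x)] with t h1 h2 h3
        rw [h1, RingHom.id_apply, h3, Pi.smul_apply, h2]
        by_cases ht : t ∈ s <;> simp [ht] }
    (μ.real s ^ (1 / p.toReal)) fun x => by
      rw [mul_comm]
      exact norm_indicatorConstLp_le (hs := hs) (hμs := measure_ne_top μ s)

theorem indicatorConstLpL_coeFn {s : Set α} (hs : MeasurableSet s) (x : F) :
    indicatorConstLpL (μ := μ) p hs x =ᵐ[μ] s.indicator fun _ => x :=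
  indicatorConstLp_coeFn (hs := hs) (hμs := measure_ne_top μ s)

end LpOperators

/-! ### Weak derivatives and primitives -/

section WeakDerivative

variable {F : Type*} [NormedAddCommGroup F] [NormedSpace ℝ F]

/-- A test function of zero mean is the derivative of a test function. -/
theorem exists_deriv_eq_of_integral_eq_zero {a b : ℝ} {g : ℝ → ℝ}
    (hg : ContDiff ℝ ∞ g) (hgc : HasCompactSupport g) (hgs : tsupport g ⊆ Set.Ioo a b)
    (h0 : ∫ t in Set.Icc a b, g t = 0) :
    ∃ φ : ℝ → ℝ, ContDiff ℝ ∞ φ ∧ HasCompactSupport φ ∧ tsupport φ ⊆ Set.Ioo a b ∧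
      deriv φ = g := by
  rcases (tsupport g).eq_empty_or_nonempty with he | hne
  · have : g = 0 := tsupport_eq_empty_iff.1 he
    subst this
    exact ⟨0, contDiff_const, HasCompactSupport.zero, by simp, by ext; simp⟩
  -- The primitive must be supported in a compact subset of the open interval, and `[c, d]` is one.
  -- To the right of `d` the primitive equals the full integral of `g`, which is zero.
  set c := sInf (tsupport g)
  set d := sSup (tsupport g)
  have hc : c ∈ Set.Ioo a b := hgs (IsCompact.sInf_mem hgc hne)
  have hd : d ∈ Set.Ioo a b := hgs (IsCompact.sSup_mem hgc hne)
  have hlt : ∀ t, t < c → g t = 0 := fun t ht => image_eq_zero_of_notMem_tsupport fun h =>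
    ht.not_ge (csInf_le (IsCompact.bddBelow hgc) h)
  have hgt : ∀ t, d < t → g t = 0 := fun t ht => image_eq_zero_of_notMem_tsupport fun h =>
    ht.not_ge (le_csSup (IsCompact.bddAbove hgc) h)
  have hgi : ∀ x y, IntervalIntegrable g volume x y := fun x y =>
    hg.continuous.intervalIntegrable x y
  have hab : a ≤ b := (hc.1.trans hc.2).le
  have hderiv : ∀ t, HasDerivAt (fun t => ∫ s in a..t, g s) (g t) t := fun t =>
    hg.continuous.integral_hasStrictDerivAt a t |>.hasDerivAt
  have hd' : deriv (fun t => ∫ s in a..t, g s) = g := funext fun t => (hderiv t).deriv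
  have hsub : Function.support (fun t => ∫ s in a..t, g s) ⊆ Set.Icc c d := by
    intro t ht
    by_contra hn
    refine ht ?_
    rw [Set.mem_Icc, not_and_or, not_le, not_le] at hn
    rcases hn with hn | hn
    · refine (intervalIntegral.integral_congr (g := fun _ => 0) fun s hs => hlt s ?_).trans
        (by simp)
      exact hs.2.trans_lt (max_lt hc.1 hn)
    · have h1 : ∫ s in a..b, g s = 0 := by
        rw [intervalIntegral.integral_of_le hab, ← integral_Icc_eq_integral_Ioc, h0]
      have h2 : ∫ s in t..b, g s = 0 := by
        refine (intervalIntegral.integral_congr (g := fun _ => 0) fun s hs => hgt s ?_).trans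
          (by simp)
        exact (lt_min hn hd.2).trans_le hs.1
      have h3 := intervalIntegral.integral_add_adjacent_intervals (hgi a t) (hgi t b)
      simpa [h1, h2] using h3
  have hts : tsupport (fun t => ∫ s in a..t, g s) ⊆ Set.Icc c d :=
    closure_minimal hsub isClosed_Icc
  refine ⟨fun t => ∫ s in a..t, g s, ?_, isCompact_Icc.of_isClosed_subset (isClosed_tsupport _) hts,
    hts.trans (Set.Icc_subset_Ioo hc.1 hd.2), hd'⟩
  rw [contDiff_infty_iff_deriv, hd']
  exact ⟨fun t => (hderiv t).differentiableAt, hg⟩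

theorem exists_test_integral_eq_one {a b : ℝ} (hab : a < b) :
    ∃ η : ℝ → ℝ, ContDiff ℝ ∞ η ∧ HasCompactSupport η ∧ tsupport η ⊆ Set.Ioo a b ∧
      ∫ t in Set.Icc a b, η t = 1 := by
  let η : ContDiffBump ((a + b) / 2) := ⟨(b - a) / 8, (b - a) / 4, by linarith, by linarith⟩
  have hs : tsupport (η.normed volume) ⊆ Set.Ioo a b := by
    rw [η.tsupport_normed_eq, Real.closedBall_eq_Icc]
    refine Set.Icc_subset_Ioo ?_ ?_ <;> simp only [η] <;> linarith
  refine ⟨η.normed volume, η.contDiff_normed, η.hasCompactSupport_normed, hs, ?_⟩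
  rw [setIntegral_eq_integral_of_forall_compl_eq_zero, η.integral_normed]
  exact fun t ht => image_eq_zero_of_notMem_tsupport fun h =>
    ht (Set.Ioo_subset_Icc_self (hs h))

theorem integrable_test_smul_of_integrableOn {a b : ℝ} {φ : ℝ → ℝ} (hφ : Continuous φ)
    (hc : HasCompactSupport φ) {z : ℝ → F} (hz : IntegrableOn z (Set.Icc a b)) :
    Integrable (fun t => φ t • z t) (volume.restrict (Set.Icc a b)) :=
  hz.integrable.locallyIntegrable.integrable_smul_left_of_hasCompactSupport hφ hc

theorem ae_mem_Ioo_restrict_Icc (a b : ℝ) :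
    ∀ᵐ t ∂(volume.restrict (Set.Icc a b)), t ∈ Set.Ioo a b := by
  rw [← restrict_Ioo_eq_restrict_Icc]
  exact ae_restrict_mem measurableSet_Ioo

/-- **Lemma of du Bois-Reymond**: a function with vanishing weak derivative is constant. -/
theorem exists_ae_eq_const_of_integral_deriv_smul_eq_zero [CompleteSpace F] {a b : ℝ} (hab : a < b)
    {z : ℝ → F} (hz : IntegrableOn z (Set.Icc a b))
    (h : ∀ φ : ℝ → ℝ, ContDiff ℝ ∞ φ → HasCompactSupport φ → tsupport φ ⊆ Set.Ioo a b →
      ∫ t in Set.Icc a b, deriv φ t • z t = 0) :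
    ∃ c : F, ∀ᵐ t ∂(volume.restrict (Set.Icc a b)), z t = c := by
  obtain ⟨η, hη, hηc, hηs, hη1⟩ := exists_test_integral_eq_one hab
  -- As `η` has integral one, a constant `z` would have to equal this value.
  set c : F := ∫ t in Set.Icc a b, η t • z t
  have hli : IntegrableOn (fun t => z t - c) (Set.Icc a b) :=
    Integrable.sub hz (integrable_const c)
  have key : ∀ᵐ t ∂(volume.restrict (Set.Icc a b)), t ∈ Set.Ioo a b → z t - c = 0 := by
    refine isOpen_Ioo.ae_eq_zero_of_integral_contDiff_smul_eq_zero
      (hli.integrable.locallyIntegrable.locallyIntegrableOn _) ?_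
    intro ψ h1 h2 h3
    set m : ℝ := ∫ t in Set.Icc a b, ψ t
    have i1 := integrable_test_smul_of_integrableOn h1.continuous h2 hz
    have i2 := integrable_test_smul_of_integrableOn hη.continuous hηc hz
    have j1 : IntegrableOn ψ (Set.Icc a b) := h1.continuous.integrableOn_Icc
    have j2 : IntegrableOn η (Set.Icc a b) := hη.continuous.integrableOn_Icc
    have hsm : HasCompactSupport (fun t => m * η t) := hηc.mul_left
    -- Subtracting `m η` makes the mean of `ψ` zero, so the difference is an admissible `deriv φ`;
    -- testing with it yields `∫ ψ z = m c`.
    obtain ⟨φ, hφ, hφc, hφs, hφd⟩ := exists_deriv_eq_of_integral_eq_zero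
      (a := a) (b := b) (g := fun t => ψ t - m * η t)
      (h1.sub (contDiff_const.mul hη)) (h2.sub hsm)
      ((tsupport_sub _ _).trans (Set.union_subset h3
        ((tsupport_mul_subset_right).trans hηs)))
      (by rw [integral_sub j1 (j2.const_mul m), integral_const_mul, hη1, mul_one, sub_self])
    have h4 := h φ hφ hφc hφs
    rw [hφd] at h4
    simp only [sub_smul, mul_smul] at h4
    have i3 : Integrable (fun t => m • η t • z t) (volume.restrict (Set.Icc a b)) := i2.smul m
    rw [integral_sub i1 i3, integral_smul] at h4
    simp only [smul_sub]
    rw [integral_sub i1 (j1.smul_const c), integral_smul_const]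
    exact h4
  refine ⟨c, ?_⟩
  filter_upwards [key, ae_mem_Ioo_restrict_Icc a b] with t h1 h2
  exact sub_eq_zero.1 (h1 h2)

/-- The primitive of an integrable function has that function as its weak derivative. -/
theorem integral_deriv_smul_integral [CompleteSpace F] {a b : ℝ}
    {v : ℝ → F} (hv : IntegrableOn v (Set.Icc a b)) {φ : ℝ → ℝ} (hφ : ContDiff ℝ ∞ φ)
    (hφs : tsupport φ ⊆ Set.Ioo a b) :
    ∫ t in Set.Icc a b, deriv φ t • ∫ s in a..t, v s = - ∫ t in Set.Icc a b, φ t • v t := by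
  have hφd : Continuous (deriv φ) := hφ.continuous_deriv (by simp)
  have hφb : φ b = 0 := image_eq_zero_of_notMem_tsupport fun h => (hφs h).2.false
  -- Fubini on the triangle `s ≤ t`: for fixed `s`, the integral of `deriv φ` over `[s, b]` is `φ b
  -- - φ s = -φ s`.
  have hD : MeasurableSet {x : ℝ × ℝ | x.2 ≤ x.1} := measurableSet_le measurable_snd measurable_fst
  have hint : Integrable (Function.uncurry fun t s => Set.indicator {x : ℝ × ℝ | x.2 ≤ x.1}
      (fun x => deriv φ x.1 • v x.2) (t, s))
      ((volume.restrict (Set.Icc a b)).prod (volume.restrict (Set.Icc a b))) := by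
    refine Integrable.indicator ?_ hD
    exact Integrable.smul_prod (hφd.integrableOn_Icc) hv
  calc ∫ t in Set.Icc a b, deriv φ t • ∫ s in a..t, v s
      = ∫ t in Set.Icc a b, ∫ s in Set.Icc a b, Set.indicator {x : ℝ × ℝ | x.2 ≤ x.1}
          (fun x => deriv φ x.1 • v x.2) (t, s) := by
        refine setIntegral_congr_fun measurableSet_Icc fun t ht => ?_
        have : (fun s => Set.indicator {x : ℝ × ℝ | x.2 ≤ x.1}
            (fun x => deriv φ x.1 • v x.2) (t, s))
            = Set.indicator (Set.Iic t) fun s => deriv φ t • v s := by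
          ext s; simp [Set.indicator]
        rw [this, setIntegral_indicator measurableSet_Iic, integral_smul,
          intervalIntegral.integral_of_le ht.1, ← integral_Icc_eq_integral_Ioc]
        congr 3
        ext s
        simp only [Set.mem_Icc, Set.mem_inter_iff, Set.mem_Iic]
        have := ht.2
        constructor
        · rintro ⟨h1, h2⟩; exact ⟨⟨h1, h2.trans this⟩, h2⟩
        · rintro ⟨⟨h1, _⟩, h2⟩; exact ⟨h1, h2⟩
    _ = ∫ s in Set.Icc a b, ∫ t in Set.Icc a b, Set.indicator {x : ℝ × ℝ | x.2 ≤ x.1}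
          (fun x => deriv φ x.1 • v x.2) (t, s) := integral_integral_swap hint
    _ = ∫ s in Set.Icc a b, - (φ s • v s) := by
        refine setIntegral_congr_fun measurableSet_Icc fun s hs => ?_
        have : (fun t => Set.indicator {x : ℝ × ℝ | x.2 ≤ x.1}
            (fun x => deriv φ x.1 • v x.2) (t, s))
            = Set.indicator (Set.Ici s) fun t => deriv φ t • v s := by
          ext t; simp [Set.indicator]
        have hst : Set.Icc a b ∩ Set.Ici s = Set.Icc s b := by
          ext t
          simp only [Set.mem_Icc, Set.mem_inter_iff, Set.mem_Ici]
          have := hs.1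
          constructor
          · rintro ⟨⟨_, h1⟩, h2⟩; exact ⟨h2, h1⟩
          · rintro ⟨h1, h2⟩; exact ⟨⟨this.trans h1, h2⟩, h1⟩
        simp only [this]
        rw [setIntegral_indicator measurableSet_Ici, integral_smul_const, hst,
          integral_Icc_eq_integral_Ioc, ← intervalIntegral.integral_of_le hs.2,
          intervalIntegral.integral_deriv_eq_sub
            (fun t _ => (hφ.differentiable (by simp)).differentiableAt)
            (hφd.intervalIntegrable _ _), hφb, zero_sub, neg_smul]
    _ = _ := integral_neg _

/-- A function with an integrable weak derivative is a primitive of that derivative. -/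
theorem HasWeakDeriv.exists_ae_eq_add_integral {E : Type*} [NormedAddCommGroup E] [NormedSpace ℝ E]
    [CompleteSpace F] {a b : ℝ} (hab : a < b) {e : E →L[ℝ] F} {u : ℝ → E} {v : ℝ → F}
    (hu : IntegrableOn u (Set.Icc a b)) (hv : IntegrableOn v (Set.Icc a b))
    (h : HasWeakDeriv (Set.Icc a b) e 1 u v) :
    ∃ c : F, ∀ᵐ t ∂(volume.restrict (Set.Icc a b)), e (u t) = c + ∫ s in a..t, v s := by
  have hV : IntegrableOn (fun t => ∫ s in a..t, v s) (Set.Icc a b) := by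
    refine ContinuousOn.integrableOn_Icc ?_
    have := intervalIntegral.continuousOn_primitive_interval' (a := a) (b₁ := a) (b₂ := b)
      (f := v) (μ := volume)
      (by rwa [intervalIntegrable_iff_integrableOn_Icc_of_le hab.le]) (by simp)
    rwa [Set.uIcc_of_le hab.le] at this
  have heu : IntegrableOn (fun t => e (u t)) (Set.Icc a b) := e.integrable_comp hu
  obtain ⟨c, hc⟩ := exists_ae_eq_const_of_integral_deriv_smul_eq_zero hab
    (z := fun t => e (u t) - ∫ s in a..t, v s) (heu.sub hV) (fun φ h1 h2 h3 => by
      have hd : Continuous (deriv φ) := h1.continuous_deriv (by simp)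
      have h4 := h φ h1 h2 (by rwa [interior_Icc])
      rw [iteratedDeriv_one, pow_one, neg_one_smul] at h4
      simp only [smul_sub]
      rw [integral_sub (integrable_test_smul_of_integrableOn hd h2.deriv heu)
        (integrable_test_smul_of_integrableOn hd h2.deriv hV), h4,
        integral_deriv_smul_integral hv h1 h3, sub_self])
  refine ⟨c, ?_⟩
  filter_upwards [hc] with t ht
  rw [← ht, sub_add_cancel]

end WeakDerivative

/-! ### Approximation by step functions in `L^p` -/

section StepApproximation

variable {α F : Type*} [MeasurableSpace α] {μ : Measure α}
  [NormedAddCommGroup F] {p : ℝ≥0∞}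

theorem MeasureTheory.Lp.coeFn_sum_range (f : ℕ → Lp F p μ) (N : ℕ) :
    ∀ᵐ t ∂μ, (∑ k ∈ Finset.range N, f k : Lp F p μ) t = ∑ k ∈ Finset.range N, f k t := by
  induction N with
  | zero =>
    filter_upwards [Lp.coeFn_zero F p μ] with t ht
    simpa using ht
  | succ N ih =>
    rw [Finset.sum_range_succ]
    filter_upwards [ih, Lp.coeFn_add (∑ k ∈ Finset.range N, f k) (f N)] with t h1 h2
    rw [h2, Pi.add_apply, h1, Finset.sum_range_succ]

variable [NormedSpace ℝ F] [IsFiniteMeasure μ] [hp : Fact (1 ≤ p)] {s : ℕ → Set α} {N : ℕ}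

theorem sum_indicatorConstLpL_ae_eq (hs : ∀ k, MeasurableSet (s k))
    (hd : ∀ t j k, t ∈ s j → t ∈ s k → j = k) (c : ℕ → F) :
    ∀ᵐ t ∂μ, ∀ j < N, t ∈ s j →
      (∑ k ∈ Finset.range N, indicatorConstLpL (μ := μ) p (hs k) (c k) : Lp F p μ) t = c j := by
  have h : ∀ᵐ t ∂μ, ∀ k, indicatorConstLpL (μ := μ) p (hs k) (c k) t
      = (s k).indicator (fun _ => c k) t :=
    ae_all_iff.2 fun k => indicatorConstLpL_coeFn p (hs k) (c k)
  filter_upwards [h, Lp.coeFn_sum_range (fun k => indicatorConstLpL (μ := μ) p (hs k) (c k)) N]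
    with t h1 h2 j hj hjt
  rw [h2, Finset.sum_eq_single_of_mem j (Finset.mem_range.2 hj) fun k _ hk => ?_, h1,
    Set.indicator_of_mem hjt]
  rw [h1, Set.indicator_of_notMem fun hkt => hk (hd t k j hkt hjt)]

/-- The error of a step approximation in `L^p`. -/
theorem norm_sub_sum_indicatorConstLpL_le (hs : ∀ k, MeasurableSet (s k))
    (hd : ∀ t j k, t ∈ s j → t ∈ s k → j = k) (hcov : ∀ᵐ t ∂μ, ∃ j < N, t ∈ s j)
    (w : Lp F p μ) (c : ℕ → F) (m : ℕ → ℝ) (hm : ∀ j, 0 ≤ m j)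
    (h : ∀ᵐ t ∂μ, ∀ j < N, t ∈ s j → ‖w t - c j‖ ≤ m j) :
    ‖w - ∑ k ∈ Finset.range N, indicatorConstLpL (μ := μ) p (hs k) (c k)‖
      ≤ ∑ k ∈ Finset.range N, m k * μ.real (s k) ^ (1 / p.toReal) := by
  -- The error is dominated pointwise by the real step function with values `m k`, whose norm the
  -- triangle inequality bounds.
  calc _ ≤ ‖∑ k ∈ Finset.range N, indicatorConstLpL (μ := μ) p (hs k) (m k)‖ := by
        refine Lp.norm_le_norm_of_ae_le ?_
        filter_upwards [hcov, h, sum_indicatorConstLpL_ae_eq (μ := μ) (p := p) (N := N) hs hd c,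
          sum_indicatorConstLpL_ae_eq (μ := μ) (p := p) (N := N) hs hd m,
          Lp.coeFn_sub w (∑ k ∈ Finset.range N, indicatorConstLpL (μ := μ) p (hs k) (c k))]
          with t ⟨j, hj, hjt⟩ h1 h2 h3 h4
        rw [h4, Pi.sub_apply, h2 j hj hjt, h3 j hj hjt]
        exact (h1 j hj hjt).trans (Real.le_norm_self _)
    _ ≤ _ := (norm_sum_le _ _).trans (Finset.sum_le_sum fun k _ => by
        refine (norm_indicatorConstLp_le (hs := hs k) (hμs := measure_ne_top μ _)).trans ?_
        rw [Real.norm_of_nonneg (hm k)])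

/-- In `L^∞` the cells are disjoint and only the worst one counts. Summing over the cells would lose
the factor `N`. -/
theorem norm_sub_sum_indicatorConstLpL_top_le [Fact (1 ≤ (⊤ : ℝ≥0∞))]
    (hs : ∀ k, MeasurableSet (s k))
    (hd : ∀ t j k, t ∈ s j → t ∈ s k → j = k) (hcov : ∀ᵐ t ∂μ, ∃ j < N, t ∈ s j)
    (w : Lp F ⊤ μ) (c : ℕ → F) {M : ℝ} (hM : 0 ≤ M)
    (h : ∀ᵐ t ∂μ, ∀ j < N, t ∈ s j → ‖w t - c j‖ ≤ M) :
    ‖w - ∑ k ∈ Finset.range N, indicatorConstLpL (μ := μ) ⊤ (hs k) (c k)‖ ≤ M := by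
  refine (Lp.norm_le_of_ae_bound hM ?_).trans (by simp)
  filter_upwards [hcov, h, sum_indicatorConstLpL_ae_eq (μ := μ) (p := ⊤) (N := N) hs hd c,
    Lp.coeFn_sub w (∑ k ∈ Finset.range N, indicatorConstLpL (μ := μ) ⊤ (hs k) (c k))]
    with t ⟨j, hj, hjt⟩ h1 h2 h4
  rw [h4, Pi.sub_apply, h2 j hj hjt]
  exact h1 j hj hjt

end StepApproximation

/-! ### Partition of the interval into equal half-open cells -/

section Partition

/-- The points of the partition of `[a, b]` into `N` intervals of equal length. -/
def partPoint (a b : ℝ) (N j : ℕ) : ℝ := a + j * ((b - a) / N)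

variable {a b : ℝ} {N : ℕ}

theorem partPoint_zero : partPoint a b N 0 = a := by simp [partPoint]

theorem partPoint_self (hN : N ≠ 0) : partPoint a b N N = b := by
  have : (N : ℝ) ≠ 0 := Nat.cast_ne_zero.2 hN
  simp only [partPoint]
  field_simp
  ring

theorem partPoint_succ_sub (j : ℕ) :
    partPoint a b N (j + 1) - partPoint a b N j = (b - a) / N := by
  simp only [partPoint]
  push_cast
  ring

theorem partPoint_mono (hab : a ≤ b) : Monotone (partPoint a b N) :=
  monotone_nat_of_le_succ fun j => by
    have := partPoint_succ_sub (a := a) (b := b) (N := N) j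
    have h : 0 ≤ (b - a) / N := div_nonneg (sub_nonneg.2 hab) (Nat.cast_nonneg N)
    linarith

theorem partPoint_Ioc_unique (hab : a ≤ b) (t : ℝ) (j k : ℕ)
    (hj : t ∈ Set.Ioc (partPoint a b N j) (partPoint a b N (j + 1)))
    (hk : t ∈ Set.Ioc (partPoint a b N k) (partPoint a b N (k + 1))) : j = k := by
  have hm := partPoint_mono (N := N) hab
  rcases lt_trichotomy j k with h | h | h
  · exact absurd (hj.2.trans (hm h)) (not_le.2 hk.1)
  · exact h
  · exact absurd (hk.2.trans (hm h)) (not_le.2 hj.1)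

theorem exists_mem_Ioc_partPoint (hN : N ≠ 0) {t : ℝ} (ht : t ∈ Set.Ioc a b) :
    ∃ j < N, t ∈ Set.Ioc (partPoint a b N j) (partPoint a b N (j + 1)) := by
  classical
  have hex : ∃ j, t ≤ partPoint a b N j := ⟨N, by rw [partPoint_self hN]; exact ht.2⟩
  have h0 : Nat.find hex ≠ 0 := fun h => by
    have := Nat.find_spec hex
    rw [h, partPoint_zero] at this
    exact absurd this (not_le.2 ht.1)
  obtain ⟨k, hk⟩ := Nat.exists_eq_succ_of_ne_zero h0
  have hkN : k < N := by
    have : Nat.find hex ≤ N := Nat.find_min' hex (by rw [partPoint_self hN]; exact ht.2)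
    omega
  refine ⟨k, hkN, not_le.1 (Nat.find_min hex (by omega)), ?_⟩
  have := Nat.find_spec hex
  rwa [hk] at this

theorem Ioc_partPoint_subset (hab : a ≤ b) {j : ℕ} (hj : j < N) :
    Set.Ioc (partPoint a b N j) (partPoint a b N (j + 1)) ⊆ Set.Icc a b := by
  have hm := partPoint_mono (N := N) hab
  refine Set.Ioc_subset_Icc_self.trans (Set.Icc_subset_Icc ?_ ?_)
  · exact partPoint_zero.symm.le.trans (hm (Nat.zero_le j))
  · exact (hm hj).trans (partPoint_self (by omega)).le

end Partition

/-! ### Approximation by means and the estimate for one link of the chain -/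

section SobolevEstimate

variable {E F : Type*} [NormedAddCommGroup E] [NormedSpace ℝ E]
  [NormedAddCommGroup F] [NormedSpace ℝ F] {a b : ℝ}

/-- The mean over `(c, d)`, as an operator on `L^p(a, b)`. -/
def meanL (a b c d : ℝ) (p : ℝ≥0∞) [Fact (1 ≤ p)] :
    Lp E p (volume.restrict (Set.Icc a b)) →L[ℝ] E :=
  weightedIntegralL p ((Set.Ioc c d).indicator fun _ => (d - c)⁻¹)
    (measurable_const.indicator measurableSet_Ioc).aestronglyMeasurable
    ⟨‖(d - c)⁻¹‖, fun _ => norm_indicator_le_norm_self (fun _ => (d - c)⁻¹) _⟩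

theorem meanL_apply {c d : ℝ} (h : Set.Ioc c d ⊆ Set.Icc a b) (p : ℝ≥0∞) [Fact (1 ≤ p)]
    (u : Lp E p (volume.restrict (Set.Icc a b))) :
    meanL a b c d p u = (d - c)⁻¹ • ∫ t in Set.Ioc c d, u t := by
  have : (fun t => (Set.Ioc c d).indicator (fun _ => (d - c)⁻¹) t • u t)
      = (Set.Ioc c d).indicator fun t => (d - c)⁻¹ • u t := by
    ext t
    by_cases ht : t ∈ Set.Ioc c d <;> simp [ht]
  rw [meanL, weightedIntegralL_apply, this, setIntegral_indicator measurableSet_Ioc,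
    Set.inter_eq_self_of_subset_right h, integral_smul]

variable {p q : ℝ≥0∞} [hp : Fact (1 ≤ p)] [hq : Fact (1 ≤ q)] {e : E →L[ℝ] F}
  {u : Lp E p (volume.restrict (Set.Icc a b))} {v : Lp F q (volume.restrict (Set.Icc a b))}

variable (a b p e) in
/-- The approximation of `e ∘ u` by the means of `u` over the intervals of a partition. -/
def stepL (N : ℕ) : Lp E p (volume.restrict (Set.Icc a b)) →L[ℝ]
    Lp F p (volume.restrict (Set.Icc a b)) :=
  ∑ k ∈ Finset.range N,
    (indicatorConstLpL (s := Set.Ioc (partPoint a b N k) (partPoint a b N (k + 1))) p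
      measurableSet_Ioc).comp (e.comp (meanL a b (partPoint a b N k) (partPoint a b N (k + 1)) p))

/-- Each summand factors through the compact `e`, between the mean operator and the embedding of
constants on a cell. -/
theorem IsCompactOperator.stepL (he : IsCompactOperator e) (N : ℕ) :
    IsCompactOperator (stepL a b p e N) := by
  refine Submodule.sum_mem (compactOperator (RingHom.id ℝ) _ _) fun k _ => ?_
  exact IsCompactOperator.clm_comp (he.comp_clm
    (meanL a b (partPoint a b N k) (partPoint a b N (k + 1)) p))
    (indicatorConstLpL p measurableSet_Ioc)

theorem stepL_apply (N : ℕ) (u : Lp E p (volume.restrict (Set.Icc a b))) :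
    stepL a b p e N u = ∑ k ∈ Finset.range N,
      indicatorConstLpL (s := Set.Ioc (partPoint a b N k) (partPoint a b N (k + 1))) p
        measurableSet_Ioc (e (meanL a b (partPoint a b N k) (partPoint a b N (k + 1)) p u)) := by
  simp [stepL]

theorem volume_real_restrict_Ioc_partPoint (hab : a ≤ b) {N k : ℕ} (hk : k < N) :
    (volume.restrict (Set.Icc a b)).real (Set.Ioc (partPoint a b N k) (partPoint a b N (k + 1)))
      = (b - a) / N := by
  rw [measureReal_restrict_apply measurableSet_Ioc,
    Set.inter_eq_self_of_subset_left (Ioc_partPoint_subset hab hk),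
    Real.volume_real_Ioc_of_le (partPoint_mono hab (Nat.le_succ k)), partPoint_succ_sub]

theorem ae_exists_mem_Ioc_partPoint {N : ℕ} (hN : N ≠ 0) :
    ∀ᵐ t ∂(volume.restrict (Set.Icc a b)),
      ∃ j < N, t ∈ Set.Ioc (partPoint a b N j) (partPoint a b N (j + 1)) := by
  filter_upwards [ae_mem_Ioo_restrict_Icc a b] with t ht
  exact exists_mem_Ioc_partPoint hN (Set.Ioo_subset_Ioc_self ht)

variable [CompleteSpace E] [CompleteSpace F]

/-- The oscillation of a function around its mean is controlled by its weak derivative. -/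
theorem HasWeakDeriv.ae_norm_sub_meanL_le (hab : a < b) (h : HasWeakDeriv (Set.Icc a b) e 1 u v) :
    ∀ᵐ t ∂(volume.restrict (Set.Icc a b)), ∀ c d : ℝ, c < d → Set.Ioc c d ⊆ Set.Icc a b →
      t ∈ Set.Ioc c d → ‖e (u t) - e (meanL a b c d p u)‖ ≤ ∫ s in Set.Ioc c d, ‖v s‖ := by
  have hu : IntegrableOn u (Set.Icc a b) := (Lp.memLp u).integrable hp.out
  have hv : IntegrableOn v (Set.Icc a b) := (Lp.memLp v).integrable hq.out
  obtain ⟨x, hx⟩ := h.exists_ae_eq_add_integral hab hu hv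
  filter_upwards [hx] with t ht c d hcd hI htI
  have hcd' : 0 < d - c := sub_pos.2 hcd
  have hvi : ∀ y ∈ Set.Icc a b, IntervalIntegrable v volume a y := fun y hy => by
    rw [intervalIntegrable_iff_integrableOn_Icc_of_le hy.1]
    exact hv.mono_set (Set.Icc_subset_Icc_right hy.2)
  have hae : ∀ᵐ s ∂(volume.restrict (Set.Ioc c d)), e (u s) = x + ∫ r in a..s, v r :=
    ae_restrict_of_ae_restrict_of_subset hI hx
  have hui : IntegrableOn (fun s => e (u s)) (Set.Ioc c d) := e.integrable_comp (hu.mono_set hI)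
  -- The deviation from the mean is the mean of the differences `e (u t) - e (u s)`, and each of
  -- these is an integral of `v` between two points of the cell.
  have hmean : e (u t) - e (meanL a b c d p u)
      = (d - c)⁻¹ • ∫ s in Set.Ioc c d, (e (u t) - e (u s)) := by
    rw [integral_sub (integrable_const _) hui, setIntegral_const, meanL_apply hI, map_smul,
      ← ContinuousLinearMap.integral_comp_comm e (hu.mono_set hI), smul_sub, smul_smul]
    rw [Real.volume_real_Ioc_of_le hcd.le, inv_mul_cancel₀ hcd'.ne', one_smul]
  rw [hmean, norm_smul, norm_inv, Real.norm_of_nonneg hcd'.le]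
  have hb : ‖∫ s in Set.Ioc c d, (e (u t) - e (u s))‖
      ≤ (∫ s in Set.Ioc c d, ‖v s‖) * volume.real (Set.Ioc c d) := by
    refine norm_setIntegral_le_of_norm_le_const_ae measure_Ioc_lt_top ?_
    filter_upwards [hae, ae_restrict_mem measurableSet_Ioc] with s hs hsI
    rw [ht, hs, add_sub_add_left_eq_sub,
      intervalIntegral.integral_interval_sub_left (hvi t (hI htI)) (hvi s (hI hsI))]
    refine intervalIntegral.norm_integral_le_integral_norm_uIoc.trans ?_
    refine setIntegral_mono_set (hv.mono_set hI).norm (.of_forall fun _ => norm_nonneg _) ?_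
    refine LE.le.eventuallyLE fun r hr => ?_
    exact ⟨(lt_min hsI.1 htI.1).trans hr.1, hr.2.trans (max_le hsI.2 htI.2)⟩
  rw [Real.volume_real_Ioc_of_le hcd.le] at hb
  calc _ ≤ (d - c)⁻¹ * ((∫ s in Set.Ioc c d, ‖v s‖) * (d - c)) := by gcongr
    _ = _ := by field_simp

theorem HasWeakDeriv.ae_norm_sub_partPoint_le (hab : a < b)
    (h : HasWeakDeriv (Set.Icc a b) e 1 u v) (N : ℕ) :
    ∀ᵐ t ∂(volume.restrict (Set.Icc a b)), ∀ j < N,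
      t ∈ Set.Ioc (partPoint a b N j) (partPoint a b N (j + 1)) →
      ‖e.compLpL p _ u t - e (meanL a b (partPoint a b N j) (partPoint a b N (j + 1)) p u)‖
        ≤ ∫ s in Set.Ioc (partPoint a b N j) (partPoint a b N (j + 1)), ‖v s‖ := by
  filter_upwards [h.ae_norm_sub_meanL_le hab, e.coeFn_compLpL u] with t h1 h2 j hj hjt
  rw [h2]
  exact h1 _ _ (hjt.1.trans_le hjt.2) (Ioc_partPoint_subset hab.le hj) hjt

/-- On a cell the error is at most the integral of `‖v‖` over it, and the cell contributes the
factor `((b - a) / N) ^ (1 / p)`. The cell integrals add up to the integral over `[a, b]`, so `q =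
1` is allowed; for `p < ∞` the bound tends to zero. -/
theorem HasWeakDeriv.norm_sub_stepL_le (hab : a < b) (h : HasWeakDeriv (Set.Icc a b) e 1 u v)
    {N : ℕ} (hN : N ≠ 0) :
    ‖e.compLpL p _ u - stepL a b p e N u‖
      ≤ (b - a) ^ (1 - 1 / q.toReal) * ‖v‖ * ((b - a) / N) ^ (1 / p.toReal) := by
  have hv : IntegrableOn v (Set.Icc a b) := (Lp.memLp v).integrable hq.out
  have hm := partPoint_mono (N := N) hab.le
  have h1 := norm_sub_sum_indicatorConstLpL_le (fun _ => measurableSet_Ioc)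
    (partPoint_Ioc_unique (N := N) hab.le) (ae_exists_mem_Ioc_partPoint hN) (e.compLpL p _ u)
    _ _ (fun j => integral_nonneg fun _ => norm_nonneg _) (h.ae_norm_sub_partPoint_le hab N)
  rw [stepL_apply]
  refine h1.trans ?_
  have h3 : ∑ k ∈ Finset.range N, ∫ s in Set.Ioc (partPoint a b N k) (partPoint a b N (k + 1)), ‖v s‖
      = ∫ s in Set.Icc a b, ‖v s‖ := by
    have h4 := intervalIntegral.sum_integral_adjacent_intervals (a := partPoint a b N) (n := N)
      (f := fun s => ‖v s‖) (μ := volume) fun k hk => by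
        rw [intervalIntegrable_iff_integrableOn_Ioc_of_le (hm (Nat.le_succ k))]
        exact (hv.mono_set (Ioc_partPoint_subset hab.le hk)).norm
    rw [partPoint_zero, partPoint_self hN, intervalIntegral.integral_of_le hab.le,
      ← integral_Icc_eq_integral_Ioc] at h4
    rw [← h4]
    exact Finset.sum_congr rfl fun k _ =>
      (intervalIntegral.integral_of_le (hm (Nat.le_succ k))).symm
  have h5 := Lp.integral_norm_le q v
  rw [measureReal_restrict_apply MeasurableSet.univ, Set.univ_inter,
    Real.volume_real_Icc_of_le hab.le] at h5
  rw [Finset.sum_congr rfl fun k hk => by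
    rw [volume_real_restrict_Ioc_partPoint hab.le (Finset.mem_range.1 hk)],
    ← Finset.sum_mul, h3]
  have : 0 ≤ (b - a) / N := div_nonneg (sub_nonneg.2 hab.le) (Nat.cast_nonneg N)
  gcongr

/-- Here smallness comes from Hölder applied to `v` on a single cell, so the bound tends to zero
only if `q > 1`. -/
theorem HasWeakDeriv.norm_sub_stepL_top_le (hab : a < b)
    {u : Lp E ⊤ (volume.restrict (Set.Icc a b))} (h : HasWeakDeriv (Set.Icc a b) e 1 u v)
    {N : ℕ} (hN : N ≠ 0) :
    ‖e.compLpL ⊤ _ u - stepL a b ⊤ e N u‖ ≤ ((b - a) / N) ^ (1 - 1 / q.toReal) * ‖v‖ := by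
  have hL : 0 ≤ (b - a) / N := div_nonneg (sub_nonneg.2 hab.le) (Nat.cast_nonneg N)
  rw [stepL_apply]
  refine norm_sub_sum_indicatorConstLpL_top_le (fun _ => measurableSet_Ioc)
    (partPoint_Ioc_unique (N := N) hab.le) (ae_exists_mem_Ioc_partPoint hN) (e.compLpL ⊤ _ u)
    _ (by positivity) ?_
  filter_upwards [h.ae_norm_sub_partPoint_le hab N] with t ht j hj hjt
  refine (ht j hj hjt).trans ?_
  have h5 := Lp.setIntegral_norm_le q v (Set.Ioc (partPoint a b N j) (partPoint a b N (j + 1)))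
  rwa [volume_real_restrict_Ioc_partPoint hab.le hj, Measure.restrict_restrict measurableSet_Ioc,
    Set.inter_eq_self_of_subset_left (Ioc_partPoint_subset hab.le hj)] at h5

theorem tendsto_div_natCast_rpow (L : ℝ) {r : ℝ} (hr : 0 < r) :
    Filter.Tendsto (fun N : ℕ => (L / N) ^ r) Filter.atTop (nhds 0) := by
  have h := (tendsto_const_div_atTop_nhds_zero_nat L).rpow_const (p := r) (Or.inr hr.le)
  rwa [Real.zero_rpow hr.ne'] at h

/-- On functions with a weak derivative, composition with a compact operator is a limit of compact
operators on `L^p`. -/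
theorem IsCompactOperator.exists_norm_compLpL_sub_le (he : IsCompactOperator e) (hab : a ≤ b)
    (hpq : p < ⊤ ∨ 1 < q) {ε : ℝ} (hε : 0 < ε) :
    ∃ S : Lp E p (volume.restrict (Set.Icc a b)) →L[ℝ] Lp F p (volume.restrict (Set.Icc a b)),
      IsCompactOperator S ∧
      ∀ (u : Lp E p (volume.restrict (Set.Icc a b))) (v : Lp F q (volume.restrict (Set.Icc a b))),
        HasWeakDeriv (Set.Icc a b) e 1 u v → ‖e.compLpL p _ u - S u‖ ≤ ε * ‖v‖ := by
  rcases hab.eq_or_lt with rfl | hab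
  -- A degenerate interval has measure zero, so every class in `L^p` vanishes.
  · refine ⟨0, isCompactOperator_zero, fun u v _ => ?_⟩
    have h0 : e.compLpL p (volume.restrict (Set.Icc a a)) u = 0 := by
      refine Lp.ext ?_
      have : ∀ᵐ t ∂(volume.restrict (Set.Icc a a)), False := by simp
      exact this.mono fun _ => False.elim
    rw [h0]
    simp only [zero_apply, sub_zero, norm_zero]
    positivity
  · rcases eq_or_ne p ⊤ with rfl | hpt
    · have hq1 : 1 < q := hpq.resolve_left (lt_irrefl _)
      have hr : 0 < 1 - 1 / q.toReal := by
        rcases eq_or_ne q ⊤ with rfl | hqt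
        · simp
        · have h1 : 1 < q.toReal := by
            simpa using (ENNReal.toReal_lt_toReal ENNReal.one_ne_top hqt).2 hq1
          rw [sub_pos, div_lt_one (by linarith)]
          exact h1
      obtain ⟨N, hN, hN0⟩ := (((tendsto_div_natCast_rpow (b - a) hr).eventually_lt_const hε).and
        (Filter.eventually_ne_atTop 0)).exists
      refine ⟨_, he.stepL N, fun u v h => (h.norm_sub_stepL_top_le hab hN0).trans ?_⟩
      gcongr
    · have hp0 : 0 < p.toReal := ENNReal.toReal_pos (zero_lt_one.trans_le hp.out).ne' hpt
      set K := (b - a) ^ (1 - 1 / q.toReal)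
      have hK : 0 ≤ K := Real.rpow_nonneg (sub_nonneg.2 hab.le) _
      have hlim := (tendsto_div_natCast_rpow (b - a) (one_div_pos.2 hp0)).const_mul K
      rw [mul_zero] at hlim
      obtain ⟨N, hN, hN0⟩ := ((hlim.eventually_lt_const hε).and
        (Filter.eventually_ne_atTop 0)).exists
      refine ⟨_, he.stepL N, fun u v h => (h.norm_sub_stepL_le hab hN0).trans ?_⟩
      rw [mul_right_comm]
      gcongr

/-- **Ehrling's lemma** in `L^p`. -/
theorem norm_compLpL_le_of_norm_le_add {α E F G : Type*} [MeasurableSpace α] {μ : Measure α}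
    [NormedAddCommGroup E] [NormedSpace ℝ E] [NormedAddCommGroup F] [NormedSpace ℝ F]
    [NormedAddCommGroup G] [NormedSpace ℝ G] {p : ℝ≥0∞} [hp : Fact (1 ≤ p)]
    {i : E →L[ℝ] F} {e : E →L[ℝ] G} {ε C : ℝ} (hε : 0 ≤ ε) (hC : 0 ≤ C)
    (h : ∀ x, ‖i x‖ ≤ ε * ‖x‖ + C * ‖e x‖) (u : Lp E p μ) :
    ‖i.compLpL p μ u‖ ≤ ε * ‖u‖ + C * ‖e.compLpL p μ u‖ := by
  set g₁ := (Lp.memLp u).norm.toLp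
  set g₂ := (Lp.memLp (e.compLpL p μ u)).norm.toLp
  have hg₁ : ‖g₁‖ = ‖u‖ := by rw [Lp.norm_toLp, eLpNorm_norm, Lp.norm_def]
  have hg₂ : ‖g₂‖ = ‖e.compLpL p μ u‖ := by rw [Lp.norm_toLp, eLpNorm_norm, Lp.norm_def]
  calc ‖i.compLpL p μ u‖ ≤ ‖ε • g₁ + C • g₂‖ := by
        refine Lp.norm_le_norm_of_ae_le ?_
        filter_upwards [i.coeFn_compLpL u, e.coeFn_compLpL u, Lp.coeFn_add (ε • g₁) (C • g₂),
          Lp.coeFn_smul ε g₁, Lp.coeFn_smul C g₂, (Lp.memLp u).norm.coeFn_toLp,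
          (Lp.memLp (e.compLpL p μ u)).norm.coeFn_toLp] with t h1 h2 h3 h4 h5 h6 h7
        rw [h1, h3, Pi.add_apply, h4, h5, Pi.smul_apply, Pi.smul_apply, h6, h7, h2]
        exact (h (u t)).trans (Real.le_norm_self _)
    _ ≤ ‖ε • g₁‖ + ‖C • g₂‖ := norm_add_le _ _
    _ = _ := by
        rw [norm_smul, norm_smul, hg₁, hg₂, Real.norm_of_nonneg hε, Real.norm_of_nonneg hC]

/-- The compactness estimate behind the Aubin-Lions lemma. -/
theorem IsCompactOperator.exists_norm_compLpL_le {G : Type*} [NormedAddCommGroup G]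
    [NormedSpace ℝ G] {i : E →L[ℝ] G} (hi : IsCompactOperator i) {j : G →L[ℝ] F}
    (hj : Function.Injective j) (hab : a ≤ b) (hpq : p < ⊤ ∨ 1 < q) {ε : ℝ} (hε : 0 < ε) :
    ∃ C : ℝ, 0 ≤ C ∧
    ∃ S : Lp E p (volume.restrict (Set.Icc a b)) →L[ℝ] Lp F p (volume.restrict (Set.Icc a b)),
      IsCompactOperator S ∧
      ∀ (u : Lp E p (volume.restrict (Set.Icc a b))) (v : Lp F q (volume.restrict (Set.Icc a b))),
        HasWeakDeriv (Set.Icc a b) (j.comp i) 1 u v →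
          ‖i.compLpL p _ u‖ ≤ ε * (‖u‖ + ‖v‖) + C * ‖S u‖ := by
  obtain ⟨C, hC, h1⟩ := hi.exists_norm_le_add hj hε
  -- The approximation is chosen after the Ehrling constant `C`, which multiplies its error; the `+
  -- 1` guards against `C = 0`.
  obtain ⟨S, hS, h2⟩ := IsCompactOperator.exists_norm_compLpL_sub_le (e := j.comp i) (p := p)
    (q := q) (hi.clm_comp j) hab hpq (ε := ε / (C + 1)) (by positivity)
  refine ⟨C, hC, S, hS, fun u v h => ?_⟩
  have h3 := norm_compLpL_le_of_norm_le_add (e := j.comp i) hε.le hC h1 u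
  have h4 := norm_le_norm_sub_add ((j.comp i).compLpL p _ u) (S u)
  have h5 : C * (ε / (C + 1) * ‖v‖) ≤ ε * ‖v‖ := by
    rw [← mul_assoc]
    gcongr
    rw [mul_div_assoc', div_le_iff₀ (by positivity)]
    nlinarith
  have h6 := mul_le_mul_of_nonneg_left (h4.trans (add_le_add_left (h2 u v h) _)) hC
  linarith

end SobolevEstimate

/-! ### Weak derivatives under bounded operators and iteration -/

section Composition

variable {X Y Z : Type*} [NormedAddCommGroup X] [NormedSpace ℝ X]
  [NormedAddCommGroup Y] [NormedSpace ℝ Y] [NormedAddCommGroup Z] [NormedSpace ℝ Z]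
  {I : Set ℝ} {p q r : ℝ≥0∞} [Fact (1 ≤ p)] [Fact (1 ≤ q)]

theorem integral_smul_compLpL (κ : X →L[ℝ] Y) (u : Lp X p (volume.restrict I)) (g : ℝ → ℝ) :
    ∫ t in I, g t • κ.compLpL p (volume.restrict I) u t = ∫ t in I, g t • κ (u t) := by
  refine integral_congr_ae ?_
  filter_upwards [κ.coeFn_compLpL u] with t ht
  rw [ht]

theorem HasWeakDeriv.clm_comp [CompleteSpace Y] [CompleteSpace Z] {ι : X →L[ℝ] Y} {k : ℕ}
    {u : Lp X p (volume.restrict I)} {v : Lp Y q (volume.restrict I)}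
    (h : HasWeakDeriv I ι k u v) (κ : Y →L[ℝ] Z) :
    HasWeakDeriv I (κ.comp ι) k u (κ.compLpL q (volume.restrict I) v) := by
  intro φ h1 h2 h3
  have h4 := congrArg κ (h φ h1 h2 h3)
  have i1 := integrable_test_smul ι u (continuous_iteratedDeriv_test h1 k)
    (hasCompactSupport_iteratedDeriv_test h2 k)
  have i2 : Integrable (fun t => φ t • v t) (volume.restrict I) :=
    integrable_test_smul (.id ℝ Y) v h1.continuous h2
  rw [map_smul, ← κ.integral_comp_comm i1, ← κ.integral_comp_comm i2] at h4
  rw [integral_smul_compLpL]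
  simpa using h4

theorem HasWeakDeriv.of_comp {ι : Y →L[ℝ] Z} {κ : X →L[ℝ] Y} {k : ℕ}
    {u : Lp X p (volume.restrict I)} {v : ℝ → Z} (h : HasWeakDeriv I (ι.comp κ) k u v) :
    HasWeakDeriv I ι k (κ.compLpL p (volume.restrict I) u) v := by
  intro φ h1 h2 h3
  rw [← h φ h1 h2 h3]
  refine integral_congr_ae ?_
  filter_upwards [κ.coeFn_compLpL u] with t ht
  rw [ht, ContinuousLinearMap.comp_apply]

/-- The weak derivative of order `m + 1` is the weak derivative of the one of order `m`. -/
theorem HasWeakDeriv.of_succ [CompleteSpace Y] [CompleteSpace Z] {ι : X →L[ℝ] Y} {κ : Y →L[ℝ] Z}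
    {m : ℕ} {u : Lp X p (volume.restrict I)} {v : Lp Y q (volume.restrict I)} {w : ℝ → Z}
    (hv : HasWeakDeriv I ι m u v) (hw : HasWeakDeriv I (κ.comp ι) (m + 1) u w) :
    HasWeakDeriv I κ 1 v w := by
  intro φ h1 h2 h3
  -- The identity of order `m` is tested with `deriv φ`, which turns the identity of order `m + 1`
  -- into one between `v` and `w`.
  have hd : ContDiff ℝ ∞ (deriv φ) := (contDiff_infty_iff_deriv.1 h1).2
  have h4 := hv.clm_comp κ (deriv φ) hd h2.deriv ((tsupport_deriv_subset (𝕜 := ℝ)).trans h3)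
  have h5 := hw φ h1 h2 h3
  rw [iteratedDeriv_succ', h4, integral_smul_compLpL, pow_succ, mul_smul] at h5
  rw [iteratedDeriv_one, pow_one]
  exact smul_right_injective Z (pow_ne_zero m (by norm_num : (-1 : ℝ) ≠ 0)) h5

end Composition

/-! ### Composite embeddings of interlaced chains -/

section Chains

theorem chainMap_castSucc {n : ℕ} {X : Fin (n + 1) → Type*} [∀ k, NormedAddCommGroup (X k)]
    [∀ k, NormedSpace ℝ (X k)] (e : ∀ k : Fin n, X k.succ →L[ℝ] X k.castSucc) (k : Fin n) :
    chainMap e k.castSucc = (e k).comp (chainMap e k.succ) := by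
  simp [chainMap, Fin.reverseInduction_castSucc]

theorem chainMap_last {n : ℕ} {X : Fin (n + 1) → Type*} [∀ k, NormedAddCommGroup (X k)]
    [∀ k, NormedSpace ℝ (X k)] (e : ∀ k : Fin n, X k.succ →L[ℝ] X k.castSucc) :
    chainMap e (Fin.last n) = ContinuousLinearMap.id ℝ _ := by
  simp [chainMap]

/-- The composite embeddings of two interlaced chains commute with the embeddings between them. -/
theorem chainMap_interlaced {n : ℕ}
    {X : Fin (n + 2) → Type*} [∀ k, NormedAddCommGroup (X k)] [∀ k, NormedSpace ℝ (X k)]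
    {Y : Fin (n + 1) → Type*} [∀ k, NormedAddCommGroup (Y k)] [∀ k, NormedSpace ℝ (Y k)]
    (i : ∀ k : Fin (n + 1), X k.succ →L[ℝ] Y k)
    (j : ∀ k : Fin (n + 1), Y k →L[ℝ] X k.castSucc) (k : Fin (n + 1)) :
    (i k).comp (chainMap (fun k => (j k).comp (i k)) k.succ)
      = (chainMap (fun k => (i k.castSucc).comp (j k.succ)) k).comp (i (Fin.last n)) := by
  induction k using Fin.reverseInduction with
  | last =>
    -- The indices `(Fin.last n).succ` and `Fin.last (n + 1)` agree by definition but not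
    -- syntactically, so the equality is applied pointwise.
    have h := chainMap_last (fun k => (j k).comp (i k))
    rw [chainMap_last, ContinuousLinearMap.id_comp]
    refine ContinuousLinearMap.ext fun x => ?_
    exact congrArg (i (Fin.last n)) (congrArg (fun f => f x) h)
  | cast k ih =>
    have h := chainMap_castSucc (fun k => (j k).comp (i k)) k.succ
    rw [chainMap_castSucc, ContinuousLinearMap.comp_assoc, ← ih]
    refine ContinuousLinearMap.ext fun x => ?_
    exact congrArg (i k.castSucc) (congrArg (fun f => f x) h)

end Chains

/-! ### Component operators and completeness of Bochner–Sobolev spaces -/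

namespace BochnerSobolev

variable {n : ℕ} {I : Set ℝ} {X : Fin (n + 1) → Type*} [∀ k, NormedAddCommGroup (X k)]
  [∀ k, NormedSpace ℝ (X k)] {p : Fin (n + 1) → ℝ≥0∞} [∀ k, Fact (1 ≤ p k)]
  {e : ∀ k : Fin n, X k.succ →L[ℝ] X k.castSucc} [∀ k, CompleteSpace (X k)]

theorem hasWeakDeriv_weakDeriv (u : BochnerSobolev I X p e) (k : Fin n) :
    HasWeakDeriv I (e k) 1 (weakDeriv u k.succ) (weakDeriv u k.castSucc) := by
  have h1 := hasWeakDeriv u k.castSucc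
  -- No truncation occurs in the subtraction, because `k < n`.
  rw [chainMap_castSucc, show n - (k.castSucc : ℕ) = n - (k.succ : ℕ) + 1 by simp; omega] at h1
  exact (hasWeakDeriv u k.succ).of_succ h1

variable [I.OrdConnected]

theorem norm_weakDeriv_le (u : BochnerSobolev I X p e) (k : Fin (n + 1)) :
    ‖weakDeriv u k‖ ≤ ‖u‖ := by
  rw [norm_eq_sum]
  exact Finset.single_le_sum (f := fun k => ‖weakDeriv u k‖) (fun _ _ => norm_nonneg _)
    (Finset.mem_univ k)

/-- The weak derivative as an operator. -/
def weakDerivL (k : Fin (n + 1)) :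
    BochnerSobolev I X p e →L[ℝ] Lp (X k) (p k) (volume.restrict I) :=
  LinearMap.mkContinuous
    { toFun := fun u => weakDeriv u k
      map_add' := fun u v => congrArg (fun w => w k) ((jet I X p e).map_add u v)
      map_smul' := fun c u => congrArg (fun w => w k) ((jet I X p e).map_smul c u) }
    1 fun u => (norm_weakDeriv_le u k).trans (one_mul _).ge

theorem range_jet : Set.range (jet I X p e) =
    {w | ∀ k, HasWeakDeriv I (chainMap e k) (n - (k : ℕ)) (w (Fin.last n)) (w k)} := by
  ext w
  constructor
  · rintro ⟨u, rfl⟩ k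
    have h := hasWeakDeriv u k
    rwa [← weakDeriv_last] at h
  · intro h
    let u : BochnerSobolev I X p e := ⟨w (Fin.last n), fun k => ⟨w k, h k⟩⟩
    refine ⟨u, ?_⟩
    ext1 k
    exact (hasWeakDeriv u k).unique (h k)

/-- For each fixed test function the weak derivative identity equates two continuous functions of
the tuple: on a finite measure space, integration against a bounded weight is continuous on `L^p`.
-/
theorem isClosed_range_jet [IsFiniteMeasure (volume.restrict I)] :
    IsClosed (Set.range (jet I X p e)) := by
  rw [range_jet]
  simp only [HasWeakDeriv, Set.ofPred_forall]
  refine isClosed_iInter fun k => isClosed_iInter fun φ => isClosed_iInter fun h1 =>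
    isClosed_iInter fun h2 => isClosed_iInter fun _ => ?_
  have hproj : ∀ l, Continuous fun w : PiLp 1 fun k : Fin (n + 1) =>
      Lp (X k) (p k) (volume.restrict I) => w l := fun l => PiLp.continuous_apply 1 _ l
  have hbd : ∀ {g : ℝ → ℝ}, Continuous g → HasCompactSupport g → ∃ C, ∀ t, ‖g t‖ ≤ C :=
    fun hg hc => hc.exists_bound_of_continuous hg
  have c1 := continuous_iteratedDeriv_test h1 (n - (k : ℕ))
  refine isClosed_eq ?_ ?_
  · have := ((weightedIntegralL (p (Fin.last n)) _ c1.aestronglyMeasurable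
      (hbd c1 (hasCompactSupport_iteratedDeriv_test h2 _))).comp
      ((chainMap e k).compLpL (p (Fin.last n)) (volume.restrict I))).continuous.comp
        (hproj (Fin.last n))
    refine this.congr fun w => ?_
    exact integral_smul_compLpL _ _ _
  · exact ((weightedIntegralL (p k) φ h1.continuous.aestronglyMeasurable
      (hbd h1.continuous h2)).continuous.comp (hproj k)).const_smul _

/-- The jet is an isometry onto a closed subset of a complete product. Completeness of the target
turns total boundedness into compactness. -/
instance [IsFiniteMeasure (volume.restrict I)] : CompleteSpace (BochnerSobolev I X p e) := by
  have hiso : Isometry (jet I X p e) := AddMonoidHomClass.isometry_of_norm _ fun _ => rfl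
  exact (completeSpace_iff_isComplete_range hiso.isUniformInducing).2 isClosed_range_jet.isComplete

end BochnerSobolev

end

/-! ### The Aubin–Lions lemma -/

theorem mainTheorem4 {n : ℕ}
    (X : Fin (n + 2) → Type*) [∀ k, NormedAddCommGroup (X k)] [∀ k, NormedSpace ℝ (X k)]
    [∀ k, CompleteSpace (X k)]
    (Y : Fin (n + 1) → Type*) [∀ k, NormedAddCommGroup (Y k)] [∀ k, NormedSpace ℝ (Y k)]
    [∀ k, CompleteSpace (Y k)]
    (hX : ∀ k, IsReflexiveSpace (X k))
    -- the compact embeddings of X_{k+1} into Y_k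
    (i : ∀ k : Fin (n + 1), X k.succ →L[ℝ] Y k)
    (hi : ∀ k, Function.Injective (i k)) (hic : ∀ k, IsCompactOperator (i k))
    -- the continuous embeddings of Y_k into X_k
    (j : ∀ k : Fin (n + 1), Y k →L[ℝ] X k.castSucc)
    (hj : ∀ k, Function.Injective (j k))
    (p : Fin (n + 2) → ℝ≥0∞) [∀ k, Fact (1 ≤ p k)]
    (hp : ∀ k : Fin (n + 1), p k.succ < ⊤ ∨ 1 < p k.castSucc)
    (a b : ℝ) (hab : a ≤ b) :
    ∃ T : BochnerSobolev (Set.Icc a b) X p (fun k => (j k).comp (i k)) →L[ℝ]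
        BochnerSobolev (Set.Icc a b) Y (fun k => p k.succ)
          (fun k => (i k.castSucc).comp (j k.succ)),
      (∀ u, ∀ᵐ t ∂(volume.restrict (Set.Icc a b)),
        (T u).toLp t = i (Fin.last n) (u.toLp t)) ∧
      Function.Injective T ∧ IsCompactOperator T := by
  set μ := volume.restrict (Set.Icc a b)
  set L := (i (Fin.last n)).compLpL (p (Fin.last (n + 1))) μ
  -- Apply `i k` to the component of `u` in `X k.succ`; commutation of the interlaced chains then
  -- moves the embedding to the front, onto `u` itself. The orders agree since `(n + 1) - (k + 1) =
  -- n - k`.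
  have hweak : ∀ (u : BochnerSobolev (Set.Icc a b) X p (fun k => (j k).comp (i k)))
      (k : Fin (n + 1)), HasWeakDeriv (Set.Icc a b)
        (chainMap (fun k => (i k.castSucc).comp (j k.succ)) k) (n - (k : ℕ)) (L u.toLp)
        ((i k).compLpL (p k.succ) μ (u.weakDeriv k.succ)) := by
    intro u k
    have h := (BochnerSobolev.hasWeakDeriv u k.succ).clm_comp (i k)
    rw [chainMap_interlaced, show n + 1 - (k.succ : ℕ) = n - (k : ℕ) by simp] at h
    exact h.of_comp
  let T₀ : BochnerSobolev (Set.Icc a b) X p (fun k => (j k).comp (i k)) →ₗ[ℝ]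
      BochnerSobolev (Set.Icc a b) Y (fun k => p k.succ)
        (fun k => (i k.castSucc).comp (j k.succ)) :=
    { toFun := fun u => ⟨L u.toLp, fun k => ⟨_, hweak u k⟩⟩
      map_add' := fun u v => Subtype.ext (L.map_add u.toLp v.toLp)
      map_smul' := fun c u => Subtype.ext (L.map_smul c u.toLp) }
  have hT₀ : ∀ u k, (T₀ u).weakDeriv k = (i k).compLpL (p k.succ) μ (u.weakDeriv k.succ) :=
    fun u k => (BochnerSobolev.hasWeakDeriv (T₀ u) k).unique (hweak u k)
  have hnorm : ∀ u, ‖T₀ u‖ = ∑ k, ‖(i k).compLpL (p k.succ) μ (u.weakDeriv k.succ)‖ := fun u => by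
    simp only [BochnerSobolev.norm_eq_sum (T₀ u), hT₀]
  let T := T₀.mkContinuous (∑ k, ‖(i k).compLpL (p k.succ) μ‖) fun u => by
    rw [hnorm, Finset.sum_mul]
    exact Finset.sum_le_sum fun k _ => (ContinuousLinearMap.le_opNorm _ _).trans
      (mul_le_mul_of_nonneg_left (u.norm_weakDeriv_le _) (norm_nonneg _))
  have hae : ∀ u, ∀ᵐ t ∂μ, (T u).toLp t = i (Fin.last n) (u.toLp t) := fun u =>
    (i (Fin.last n)).coeFn_compLpL u.toLp
  refine ⟨T, hae, fun u v huv => ?_, ?_⟩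
  · refine Subtype.ext (Lp.ext ?_)
    filter_upwards [hae u, hae v] with t h1 h2
    exact hi _ (h1.symm.trans ((congrArg (fun w => w.toLp t) huv).trans h2))
  · refine isCompactOperator_of_norm_le_add
      (Z := ∀ k : Fin (n + 1), Lp (X k.castSucc) (p k.succ) μ) T fun ε hε => ?_
    -- There are `n + 1` components, and each estimate involves two component norms, both at most
    -- `‖u‖`.
    have hε' : 0 < ε / (2 * (n + 1)) := by positivity
    choose C hC S hS hest using fun k => (hic k).exists_norm_compLpL_le (hj k) hab (hp k) hε'
    -- One compact operator collects the compact parts of all components; its sup norm dominates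
    -- each of them, so the constants `C k` add up.
    set B := ContinuousLinearMap.pi fun k => (S k).comp (BochnerSobolev.weakDerivL
      (I := Set.Icc a b) (X := X) (p := p) (e := fun k => (j k).comp (i k)) k.succ)
    refine ⟨∑ k, C k, B, IsCompactOperator.clm_pi fun k => (hS k).comp_clm _, fun u => ?_⟩
    calc ‖T u‖ = ∑ k, ‖(i k).compLpL (p k.succ) μ (u.weakDeriv k.succ)‖ := hnorm u
      _ ≤ ∑ k, (ε / (2 * (n + 1)) * (‖u‖ + ‖u‖) + C k * ‖B u‖) := by
          refine Finset.sum_le_sum fun k _ =>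
            (hest k _ _ (u.hasWeakDeriv_weakDeriv k)).trans ?_
          have h1 := u.norm_weakDeriv_le k.succ
          have h2 := u.norm_weakDeriv_le k.castSucc
          have h3 : ‖S k (u.weakDeriv k.succ)‖ ≤ ‖B u‖ := norm_le_pi_norm (B u) k
          have h4 := hC k
          gcongr
      _ = _ := by
          rw [Finset.sum_add_distrib, ← Finset.sum_mul Finset.univ C, Finset.sum_const,
            Finset.card_univ, Fintype.card_fin, nsmul_eq_mul]
          push_cast
          field_simp
          ring
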